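/- A \emph{cone} in $\mathbb R^d$ is a set $C=\mathbb R_+x_1+\cdots+\mathbb R_+x_n$ with $n\ge 0$ and $x_1,\dots,x_n\in\mathbb Z^d$ that contains no nonzero $x$ together with $-x$ (the zero cone $\{0\}$ is allowed). Put $\mathsf L(C)=C\cap\mathbb Z^d$. A pair of cones $C\subset D$ is an \emph{elementary extension} if there is a lattice vector $x\in D\setminus C$ such that $\mathsf L(D)=\mathsf L(C)+\mathbb Z_+x$. Let $\operatorname{Cones}(d)$ be the set of all cones in $\mathbb R^d$, partially ordered as follows: $C\le D$ if there is a finite chain of cones $C=C_0\subset C_1\subset\cdots\subset C_n=D$, $n\ge 0$, in which every $C_{i-1}\subset C_i$, $1\le i\le n$, is an elementary extension; and $C<D$ if there is such a chain with $n\ge1$. \textbf{Theorem.} The order in $\operatorname{Cones}(3)$ is the inclusion order: for all cones $C,D$ in $\mathbb R^3$, one has $C\le D$ if and only if $C\subseteq D$, and $C<D$ if and only if $C\subsetneq D$. -/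

import Mathlib

/-- The inclusion of the integer lattice `ℤ^d` into `ℝ^d`. -/
def latticeIncl (d : ℕ) : (Fin d → ℤ) →+ (Fin d → ℝ) :=
  (Int.castAddHom ℝ).compLeft (Fin d)

/-- The set `Cones(d)`. A cone in `ℝ^d` is the set of nonnegative real combinations of finitely many
integer vectors (rational, polyhedral) that contains no `x ≠ 0` together with `-x`
(called *pointed* in toric geometry, *salient* in Mathlib). The zero cone is allowed. -/
@[ext]
structure Cones (d : ℕ) where
  /-- The underlying convex cone (Mathlib's `PointedCone` only requires that it contains `0`). -/
  cone : PointedCone ℝ (Fin d → ℝ)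
  /-- The cone is generated by finitely many lattice vectors. -/
  rational : ∃ S : Finset (Fin d → ℤ),
    cone = PointedCone.hull ℝ (latticeIncl d '' (S : Set (Fin d → ℤ)))
  /-- The cone contains no line. -/
  salient : ∀ x ∈ cone, -x ∈ cone → x = 0

namespace Cones

variable {d : ℕ}

/-- The monoid `L(C) = C ∩ ℤ^d` of lattice points of a cone, as a submonoid of `ℤ^d`. -/
def latticePoints (C : Cones d) : AddSubmonoid (Fin d → ℤ) :=
  C.cone.toAddSubmonoid.comap (latticeIncl d)

/-- `C ⊆ D` is an elementary extension: `L(D) = L(C) + ℤ₊ x` for some lattice vector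
`x ∈ D \ C`. -/
def IsElementaryExtension (C D : Cones d) : Prop :=
  (C.cone : Set (Fin d → ℝ)) ⊆ D.cone ∧
    ∃ x : Fin d → ℤ, x ∈ D.latticePoints ∧ x ∉ C.latticePoints ∧
      ∀ y : Fin d → ℤ,
        y ∈ D.latticePoints ↔ ∃ u ∈ C.latticePoints, ∃ n : ℕ, y = u + n • x

theorem IsElementaryExtension.ssubset {C D : Cones d} (h : IsElementaryExtension C D) :
    (C.cone : Set (Fin d → ℝ)) ⊂ D.cone := by
  obtain ⟨hs, x, hxD, hxC, -⟩ := h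
  exact ⟨hs, fun h' => hxC (h' hxD)⟩

theorem ssubset_of_transGen {C D : Cones d}
    (h : Relation.TransGen IsElementaryExtension C D) : (C.cone : Set (Fin d → ℝ)) ⊂ D.cone := by
  induction h with
  | single h => exact h.ssubset
  | tail _ h ih => exact ih.trans h.ssubset

/-- The order of the poset `Cones(d)`: `C ≤ D` if a finite chain `C = C₀ ⊂ C₁ ⊂ ⋯ ⊂ Cₙ = D` of
elementary extensions leads from `C` to `D`, and `C < D` if there is such a chain with `n ≥ 1`. -/
instance : PartialOrder (Cones d) where
  le C D := Relation.ReflTransGen IsElementaryExtension C D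
  lt C D := Relation.TransGen IsElementaryExtension C D
  le_refl _ := Relation.ReflTransGen.refl
  le_trans _ _ _ h₁ h₂ := h₁.trans h₂
  lt_iff_le_not_ge C D := by
    constructor
    · intro h
      refine ⟨h.to_reflTransGen, fun h' => ?_⟩
      exact (ssubset_of_transGen (h.trans_left h')).ne rfl
    · rintro ⟨h, h'⟩
      rcases Relation.reflTransGen_iff_eq_or_transGen.1 h with rfl | h
      · exact absurd Relation.ReflTransGen.refl h'
      · exact h
  le_antisymm C D h₁ h₂ := by
    rcases Relation.reflTransGen_iff_eq_or_transGen.1 h₁ with h | h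
    · exact h.symm
    · exact absurd rfl (ssubset_of_transGen (h.trans_left h₂)).ne

end Cones

/-! Elementary extensions strictly enlarge the cone, so all the content is in: inclusion implies
`≤`.

The core case is a lattice vector `v` added to `C` beyond a facet spanned by lattice vectors `a, b`,
where beyond the plane of `a, b` the new cone `D` agrees with the simplicial cone on `a, b, v`. Let
`E` be generated by `C` and the lattice points of the half-open parallelepiped on `a, b, v`. Taking
integer parts of the coordinates writes each lattice point of `D` beyond the facet as a box point
plus nonnegative integer multiples of `a, b, v`. Hence `L(D) = L(E) + ℤ₊ v`, so `E ⊂ D` is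
elementary unless `E = D`. It remains to climb from `C` to `E`. A sweep turns the cutting plane
around `b` and adds box points one at a time, each beyond a facet `a', b`, with determinant strictly
below that of `a, b, v`. Determinants are integers, so induction on the determinant closes the
argument (`le_of_isFacet_of_vol_lt`).

The same sweep, without the bound on determinants, handles any cone cut by a plane along a facet
(`IsFacet.cones_le`). If `C` spans the space, intersecting `D` with the half-spaces defining `C`,
one at a time, gives a chain in which each step is trivial or crosses one facet
(`le_of_linearSpan_eq_top`).

Smaller cones are treated by descending induction on dimension. Inside a hyperplane, a transversal
vector is added to both cones; a chain between the enlarged cones restricts to a chain between the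
original ones, which are faces (`le_of_le_face`, `le_of_vanishing`). If `D` leaves a hyperplane
containing `C`, one vector of `D` outside it is added first (`le_of_cone_le`). -/

open Matrix

/-! ### Rational polyhedral cones: generators versus inequalities. -/

section Polyhedral

variable {d : ℕ}

theorem latticeIncl_apply (v : Fin d → ℤ) (i : Fin d) : latticeIncl d v i = (v i : ℝ) := rfl

theorem latticeIncl_zsmul (k : ℤ) (v : Fin d → ℤ) :
    latticeIncl d (k • v) = (k : ℝ) • latticeIncl d v := by
  ext i; simp [latticeIncl_apply]

theorem latticeIncl_dotProduct (v w : Fin d → ℤ) :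
    latticeIncl d v ⬝ᵥ latticeIncl d w = ((v ⬝ᵥ w : ℤ) : ℝ) := by
  simp [dotProduct, latticeIncl_apply]

theorem mem_sup_hull_singleton {E : Type*} [AddCommGroup E] [Module ℝ E] {P : PointedCone ℝ E}
    {v y : E} : y ∈ P ⊔ PointedCone.hull ℝ {v} ↔ ∃ c ∈ P, ∃ s : ℝ, 0 ≤ s ∧ y = c + s • v := by
  rw [Submodule.mem_sup]
  constructor
  · rintro ⟨c, hc, z, hz, rfl⟩
    obtain ⟨s, rfl⟩ := Submodule.mem_span_singleton.1 hz
    exact ⟨c, hc, s, s.2, rfl⟩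
  · rintro ⟨c, hc, s, hs, rfl⟩
    exact ⟨c, hc, _, PointedCone.smul_mem _ hs (PointedCone.subset_hull rfl), rfl⟩

theorem hull_insert {E : Type*} [AddCommGroup E] [Module ℝ E] (v : E) (S : Set E) :
    PointedCone.hull ℝ (insert v S) = PointedCone.hull ℝ S ⊔ PointedCone.hull ℝ {v} := by
  rw [PointedCone.hull, Submodule.span_insert, sup_comm]

/-- Fourier–Motzkin elimination: a rational polyhedral cone is cut out by finitely many integral
linear inequalities. -/
theorem exists_halfspaces_of_hull (S : Finset (Fin d → ℤ)) : ∃ M : Finset (Fin d → ℤ),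
    ∀ y, y ∈ PointedCone.hull ℝ (latticeIncl d '' (S : Set (Fin d → ℤ))) ↔
      ∀ m ∈ M, latticeIncl d m ⬝ᵥ y ≤ 0 := by
  classical
  induction S using Finset.induction_on with
  | empty =>
    refine ⟨Finset.univ.image (fun i => Pi.single i 1) ∪
      Finset.univ.image (fun i => -Pi.single i 1), fun y => ?_⟩
    have key : ∀ i, latticeIncl d (Pi.single i 1) = Pi.single i 1 := by
      intro i; ext j; simp [latticeIncl_apply, Pi.single_apply]
    simp only [Finset.coe_empty, Set.image_empty, Submodule.span_empty, Submodule.mem_bot,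
      Finset.mem_union, Finset.mem_image, Finset.mem_univ, true_and]
    constructor
    · rintro rfl m -; simp
    · intro h
      ext i
      have h1 := h _ (Or.inl ⟨i, rfl⟩)
      have h2 := h _ (Or.inr ⟨i, rfl⟩)
      rw [map_neg] at h2
      rw [key] at h1 h2
      simp at h1 h2
      exact le_antisymm h1 h2
  | insert v S _ ih =>
    obtain ⟨M, hM⟩ := ih
    refine ⟨M.filter (fun m => m ⬝ᵥ v ≤ 0) ∪ Finset.image₂
      (fun m m' => (m ⬝ᵥ v) • m' - (m' ⬝ᵥ v) • m) (M.filter (fun m => 0 < m ⬝ᵥ v))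
      (M.filter (fun m => m ⬝ᵥ v ≤ 0)), fun y => ?_⟩
    rw [Finset.coe_insert, Set.image_insert_eq, hull_insert, mem_sup_hull_singleton]
    constructor
    · rintro ⟨c, hc, s, hs, rfl⟩ m hm
      rw [hM] at hc
      rcases Finset.mem_union.1 hm with hm | hm
      · obtain ⟨hm, hmv⟩ := Finset.mem_filter.1 hm
        rw [dotProduct_add, dotProduct_smul, latticeIncl_dotProduct]
        have : ((m ⬝ᵥ v : ℤ) : ℝ) ≤ 0 := by exact_mod_cast hmv
        have := mul_nonpos_of_nonneg_of_nonpos hs this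
        have := hc m hm
        simp only [smul_eq_mul]; linarith
      · obtain ⟨p, hp, q, hq, rfl⟩ := Finset.mem_image₂.1 hm
        obtain ⟨hp, hpv⟩ := Finset.mem_filter.1 hp
        obtain ⟨hq, hqv⟩ := Finset.mem_filter.1 hq
        have h1 : 0 < ((p ⬝ᵥ v : ℤ) : ℝ) := by exact_mod_cast hpv
        have h2 : ((q ⬝ᵥ v : ℤ) : ℝ) ≤ 0 := by exact_mod_cast hqv
        rw [map_sub, latticeIncl_zsmul, latticeIncl_zsmul, sub_dotProduct, smul_dotProduct,
          smul_dotProduct, dotProduct_add, dotProduct_add, dotProduct_smul, dotProduct_smul,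
          latticeIncl_dotProduct, latticeIncl_dotProduct]
        simp only [smul_eq_mul]
        nlinarith [mul_nonneg h1.le (neg_nonneg.2 (hc q hq)),
          mul_nonneg (neg_nonneg.2 h2) (neg_nonneg.2 (hc p hp))]
    · intro h
      have hneg : ∀ m ∈ M, m ⬝ᵥ v ≤ 0 → latticeIncl d m ⬝ᵥ y ≤ 0 := fun m hm hmv =>
        h m (Finset.mem_union_left _ (Finset.mem_filter.2 ⟨hm, hmv⟩))
      have hmix : ∀ p ∈ M, ∀ q ∈ M, 0 < p ⬝ᵥ v → q ⬝ᵥ v ≤ 0 →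
          ((p ⬝ᵥ v : ℤ) : ℝ) * (latticeIncl d q ⬝ᵥ y) ≤
            ((q ⬝ᵥ v : ℤ) : ℝ) * (latticeIncl d p ⬝ᵥ y) := fun p hp q hq hpv hqv => by
        have := h _ (Finset.mem_union_right _ (Finset.mem_image₂_of_mem
          (Finset.mem_filter.2 ⟨hp, hpv⟩) (Finset.mem_filter.2 ⟨hq, hqv⟩)))
        rw [map_sub, latticeIncl_zsmul, latticeIncl_zsmul, sub_dotProduct, smul_dotProduct,
          smul_dotProduct] at this
        simpa using this
      -- The conditions on `t` are lower bounds when `m ⬝ᵥ v > 0` and upper bounds when `m ⬝ᵥ v <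
      -- 0`. The largest lower bound, or `0` if none is positive, is a solution: the mixed
      -- inequalities keep it below every upper bound.
      suffices ∃ t : ℝ, 0 ≤ t ∧ ∀ m ∈ M, latticeIncl d m ⬝ᵥ y ≤ t * ((m ⬝ᵥ v : ℤ) : ℝ) by
        obtain ⟨t, ht, hty⟩ := this
        refine ⟨y - t • latticeIncl d v, (hM _).2 fun m hm => ?_, t, ht, by abel⟩
        rw [dotProduct_sub, dotProduct_smul, latticeIncl_dotProduct, smul_eq_mul]
        linarith [hty m hm]
      by_cases hne : ∃ p ∈ M, 0 < p ⬝ᵥ v ∧ 0 < latticeIncl d p ⬝ᵥ y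
      · obtain ⟨p₀, hp₀, hp₀v, hp₀y⟩ := hne
        obtain ⟨p, hp, hmax⟩ := (M.filter (fun m => 0 < m ⬝ᵥ v)).exists_max_image
          (fun m => (latticeIncl d m ⬝ᵥ y) / ((m ⬝ᵥ v : ℤ) : ℝ))
          ⟨p₀, Finset.mem_filter.2 ⟨hp₀, hp₀v⟩⟩
        obtain ⟨hp, hpv⟩ := Finset.mem_filter.1 hp
        have hpv' : 0 < ((p ⬝ᵥ v : ℤ) : ℝ) := by exact_mod_cast hpv
        refine ⟨(latticeIncl d p ⬝ᵥ y) / ((p ⬝ᵥ v : ℤ) : ℝ), ?_, fun m hm => ?_⟩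
        · have h0 : 0 < ((p₀ ⬝ᵥ v : ℤ) : ℝ) := by exact_mod_cast hp₀v
          exact (div_pos hp₀y h0).le.trans (hmax p₀ (Finset.mem_filter.2 ⟨hp₀, hp₀v⟩))
        · rcases lt_or_ge 0 (m ⬝ᵥ v) with hmv | hmv
          · have h0 : 0 < ((m ⬝ᵥ v : ℤ) : ℝ) := by exact_mod_cast hmv
            have := hmax m (Finset.mem_filter.2 ⟨hm, hmv⟩)
            rwa [div_le_iff₀ h0] at this
          · have := hmix p hp m hm hpv hmv
            rw [div_mul_eq_mul_div, le_div_iff₀ hpv']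
            linarith
      · push Not at hne
        refine ⟨0, le_rfl, fun m hm => ?_⟩
        rw [zero_mul]
        rcases lt_or_ge 0 (m ⬝ᵥ v) with hmv | hmv
        · exact hne m hm hmv
        · exact hneg m hm hmv

/-- A cone cut out by finitely many integral linear inequalities is generated by finitely many
lattice vectors. -/
theorem exists_hull_of_halfspaces (M : Finset (Fin d → ℤ)) : ∃ S : Finset (Fin d → ℤ),
    ∀ y, y ∈ PointedCone.hull ℝ (latticeIncl d '' (S : Set (Fin d → ℤ))) ↔
      ∀ m ∈ M, latticeIncl d m ⬝ᵥ y ≤ 0 := by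
  -- Bipolar argument: `K` consists of normals of the cone on `M`, and `L` of normals of the cone on
  -- `K`. Each `l ∈ L` is nonpositive on `K`, so it lies in the cone on `M`; the inequalities from
  -- `M` therefore imply those from `L`.
  obtain ⟨K, hK⟩ := exists_halfspaces_of_hull M
  obtain ⟨L, hL⟩ := exists_halfspaces_of_hull K
  refine ⟨K, fun y => ⟨fun hy m hm => ?_, fun hy => (hL y).2 fun l hl => ?_⟩⟩
  · have hm' := (hK _).1 (PointedCone.subset_hull (Set.mem_image_of_mem (latticeIncl d) hm))
    induction hy using Submodule.span_induction with
    | mem x hx =>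
      obtain ⟨k, hk, rfl⟩ := hx
      rw [dotProduct_comm]; exact hm' k hk
    | zero => simp
    | add x z _ _ hx hz => rw [dotProduct_add]; linarith
    | smul a x _ hx =>
      rw [show a • x = (a : ℝ) • x from rfl, dotProduct_smul]
      exact mul_nonpos_of_nonneg_of_nonpos a.2 hx
  · have hl' : latticeIncl d l ∈ PointedCone.hull ℝ (latticeIncl d '' (M : Set (Fin d → ℤ))) := by
      refine (hK _).2 fun k hk => ?_
      have := (hL _).1 (PointedCone.subset_hull (Set.mem_image_of_mem (latticeIncl d) hk)) l hl
      rwa [dotProduct_comm]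
    clear hl
    generalize latticeIncl d l = z at hl'
    induction hl' using Submodule.span_induction with
    | mem x hx =>
      obtain ⟨k, hk, rfl⟩ := hx
      exact hy k hk
    | zero => simp
    | add x z _ _ hx hz => rw [add_dotProduct]; linarith
    | smul a x _ hx =>
      rw [show a • x = (a : ℝ) • x from rfl, smul_dotProduct]
      exact mul_nonpos_of_nonneg_of_nonpos a.2 hx

end Polyhedral

/-! ### Intersections and sums of cones. -/

namespace Cones

variable {d : ℕ}

theorem mem_latticePoints {C : Cones d} {v : Fin d → ℤ} :
    v ∈ C.latticePoints ↔ latticeIncl d v ∈ C.cone := Iff.rfl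

theorem le_of_cone_eq {C D : Cones d} (h : C.cone = D.cone) : C ≤ D := by
  rw [Cones.ext h]

theorem cone_le_of_le {C D : Cones d} (h : C ≤ D) : C.cone ≤ D.cone := by
  rcases Relation.reflTransGen_iff_eq_or_transGen.1 h with rfl | h
  · exact le_rfl
  · exact (ssubset_of_transGen h).1

theorem exists_halfspaces (C : Cones d) : ∃ M : Finset (Fin d → ℤ),
    ∀ y, y ∈ C.cone ↔ ∀ m ∈ M, latticeIncl d m ⬝ᵥ y ≤ 0 := by
  obtain ⟨S, hS⟩ := C.rational
  rw [hS]
  exact exists_halfspaces_of_hull S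

theorem exists_inter_halfspace (E : Cones d) (n : Fin d → ℤ) : ∃ C : Cones d,
    ∀ y, y ∈ C.cone ↔ y ∈ E.cone ∧ latticeIncl d n ⬝ᵥ y ≤ 0 := by
  classical
  obtain ⟨M, hM⟩ := E.exists_halfspaces
  obtain ⟨S, hS⟩ := exists_hull_of_halfspaces (insert n M)
  have key : ∀ y, y ∈ PointedCone.hull ℝ (latticeIncl d '' (S : Set (Fin d → ℤ))) ↔
      y ∈ E.cone ∧ latticeIncl d n ⬝ᵥ y ≤ 0 := fun y => by
    rw [hS, hM, Finset.forall_mem_insert, and_comm]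
  exact ⟨⟨_, ⟨S, rfl⟩, fun x hx hx' => E.salient x ((key x).1 hx).1 ((key _).1 hx').1⟩, key⟩

/-- The cone generated by a cone `C` and finitely many lattice vectors of a larger cone. -/
theorem exists_sup_hull (C E : Cones d) (hCE : C.cone ≤ E.cone) (N : Finset (Fin d → ℤ))
    (hN : ∀ w ∈ N, w ∈ E.latticePoints) : ∃ G : Cones d,
    G.cone = C.cone ⊔ PointedCone.hull ℝ (latticeIncl d '' (N : Set (Fin d → ℤ))) ∧
      G.cone ≤ E.cone := by
  classical
  obtain ⟨S, hS⟩ := C.rational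
  have hle : C.cone ⊔ PointedCone.hull ℝ (latticeIncl d '' (N : Set (Fin d → ℤ))) ≤ E.cone := by
    refine sup_le hCE (Submodule.span_le.2 ?_)
    rintro _ ⟨w, hw, rfl⟩
    exact hN w hw
  refine ⟨⟨_, ⟨S ∪ N, ?_⟩, fun x hx hx' => E.salient x (hle hx) (hle hx')⟩, rfl, hle⟩
  rw [hS, Finset.coe_union, Set.image_union]
  exact (Submodule.span_union _ _).symm

theorem exists_sup_singleton (C E : Cones d) (hCE : C.cone ≤ E.cone) {v : Fin d → ℤ}
    (hv : v ∈ E.latticePoints) : ∃ G : Cones d,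
    G.cone = C.cone ⊔ PointedCone.hull ℝ {latticeIncl d v} ∧ G.cone ≤ E.cone := by
  obtain ⟨G, hG, hGE⟩ := exists_sup_hull C E hCE {v} (by simpa using hv)
  exact ⟨G, by simpa using hG, hGE⟩

theorem exists_eq_sup_hull {C E : Cones d} (hCE : C.cone ≤ E.cone) : ∃ N : Finset (Fin d → ℤ),
    E.cone = C.cone ⊔ PointedCone.hull ℝ (latticeIncl d '' (N : Set (Fin d → ℤ))) := by
  obtain ⟨S, hS⟩ := E.rational
  exact ⟨S, by rw [← hS, sup_eq_right.2 hCE]⟩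

/-- A linear functional that is nonpositive on generators is nonpositive on the cone. -/
theorem nonpos_of_mem_sup_hull {P : PointedCone ℝ (Fin d → ℝ)} {N : Set (Fin d → ℤ)}
    (f : (Fin d → ℝ) →ₗ[ℝ] ℝ) (hP : ∀ y ∈ P, f y ≤ 0) (hN : ∀ w ∈ N, f (latticeIncl d w) ≤ 0)
    {y : Fin d → ℝ} (hy : y ∈ P ⊔ PointedCone.hull ℝ (latticeIncl d '' N)) : f y ≤ 0 := by
  obtain ⟨c, hc, z, hz, rfl⟩ := Submodule.mem_sup.1 hy
  have : f z ≤ 0 := by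
    clear hy
    induction hz using Submodule.span_induction with
    | mem x hx =>
      obtain ⟨k, hk, rfl⟩ := hx
      exact hN k hk
    | zero => simp
    | add x z _ _ hx hz => rw [map_add]; linarith
    | smul a x _ hx =>
      rw [show a • x = (a : ℝ) • x from rfl, map_smul]
      exact mul_nonpos_of_nonneg_of_nonpos a.2 hx
  rw [map_add]
  linarith [hP c hc]

end Cones

/-! ### Determinants in dimension three. -/

/-- The oriented volume (determinant) of three vectors of `ℝ^3`. -/
def vol (a b c : Fin 3 → ℝ) : ℝ :=
  a 0 * (b 1 * c 2 - b 2 * c 1) - a 1 * (b 0 * c 2 - b 2 * c 0) + a 2 * (b 0 * c 1 - b 1 * c 0)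

/-- The oriented volume as a linear functional of its last argument. -/
def volRight (a b : Fin 3 → ℝ) : (Fin 3 → ℝ) →ₗ[ℝ] ℝ where
  toFun := vol a b
  map_add' x y := by simp only [vol, Pi.add_apply]; ring
  map_smul' r x := by simp only [vol, Pi.smul_apply, smul_eq_mul, RingHom.id_apply]; ring

theorem volRight_apply (a b c : Fin 3 → ℝ) : volRight a b c = vol a b c := rfl

theorem vol_add_right (a b x y : Fin 3 → ℝ) : vol a b (x + y) = vol a b x + vol a b y :=
  (volRight a b).map_add x y

theorem vol_smul_right (a b : Fin 3 → ℝ) (r : ℝ) (x : Fin 3 → ℝ) :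
    vol a b (r • x) = r * vol a b x :=
  (volRight a b).map_smul r x

theorem vol_self_right (a b : Fin 3 → ℝ) : vol a b b = 0 := by
  simp only [vol]; ring

theorem vol_self_left (a b : Fin 3 → ℝ) : vol a b a = 0 := by
  simp only [vol]; ring

theorem vol_swap_left (a b c : Fin 3 → ℝ) : vol b a c = -vol a b c := by
  simp only [vol]; ring

theorem vol_rotate (a b c : Fin 3 → ℝ) : vol b c a = vol a b c := by
  simp only [vol]; ring

/-- Cramer's rule. -/
theorem vol_cramer (a b c y : Fin 3 → ℝ) :
    vol a b c • y = (-vol c b y) • a + (-vol a c y) • b + vol a b y • c := by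
  ext i
  fin_cases i <;> simp [vol] <;> ring

/-- A Grassmann–Plücker relation. It turns a comparison of the ratios `vol a e · / vol a b ·` at `m`
and `w` into the sign of `vol a m w`. -/
theorem vol_plucker (a b e m w : Fin 3 → ℝ) :
    vol a b m * vol a e w - vol a b w * vol a e m = vol a b e * vol a m w := by
  simp only [vol]; ring

theorem exists_int_vol (a b c : Fin 3 → ℤ) :
    ∃ k : ℤ, vol (latticeIncl 3 a) (latticeIncl 3 b) (latticeIncl 3 c) = k := by
  refine ⟨a 0 * (b 1 * c 2 - b 2 * c 1) - a 1 * (b 0 * c 2 - b 2 * c 0) +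
    a 2 * (b 0 * c 1 - b 1 * c 0), ?_⟩
  simp only [vol, latticeIncl_apply]
  push_cast
  rfl

/-! ### Facets and the sweep around an edge. -/

namespace Cones

local notation "ι" => latticeIncl 3

/-- The plane spanned by the lattice vectors `a, b` cuts off `C` from `E`, and meets `E` in the cone
spanned by `a` and `b`. -/
structure IsFacet (C E : Cones 3) (a b : Fin 3 → ℤ) : Prop where
  le : C.cone ≤ E.cone
  left_mem : ι a ∈ C.cone
  right_mem : ι b ∈ C.cone
  nonpos : ∀ y ∈ C.cone, vol (ι a) (ι b) y ≤ 0
  mem : ∀ y ∈ E.cone, vol (ι a) (ι b) y ≤ 0 → y ∈ C.cone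
  mem_face : ∀ y ∈ E.cone, vol (ι a) (ι b) y = 0 →
    ∃ r s : ℝ, 0 ≤ r ∧ 0 ≤ s ∧ y = r • ι a + s • ι b

namespace IsFacet

variable {C E G : Cones 3} {a b m : Fin 3 → ℤ}

theorem mono (h : IsFacet C E a b) (hCG : C.cone ≤ G.cone) (hGE : G.cone ≤ E.cone) :
    IsFacet C G a b where
  le := hCG
  left_mem := h.left_mem
  right_mem := h.right_mem
  nonpos := h.nonpos
  mem y hy := h.mem y (hGE hy)
  mem_face y hy := h.mem_face y (hGE hy)

/-- The ray from `y` in direction `v` starts on the inner side of the plane of `a, b` and ends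
beyond it. It crosses the plane inside `E`, hence in the face spanned by `a` and `b`. -/
theorem exists_crossing (h : IsFacet C E a b) {v y : Fin 3 → ℝ} (hv : v ∈ E.cone)
    (hvol : 0 < vol (ι a) (ι b) v) (hy : y ∈ C.cone) :
    ∃ s p q : ℝ, 0 ≤ p ∧ 0 ≤ q ∧ y = p • ι a + q • ι b - s • v ∧ 0 ≤ s := by
  have hs : 0 ≤ -vol (ι a) (ι b) y / vol (ι a) (ι b) v :=
    div_nonneg (neg_nonneg.2 (h.nonpos y hy)) hvol.le
  obtain ⟨p, q, hp, hq, hpq⟩ := h.mem_face (y + (-vol (ι a) (ι b) y / vol (ι a) (ι b) v) • v)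
    (E.cone.add_mem (h.le hy) (E.cone.smul_mem hs hv)) (by
      rw [vol_add_right, vol_smul_right]; field_simp; ring)
  exact ⟨_, p, q, hp, hq, by rw [← hpq]; abel, hs⟩

theorem vol_left_nonpos (h : IsFacet C E a b) {v y : Fin 3 → ℝ} (hv : v ∈ E.cone)
    (hvol : 0 < vol (ι a) (ι b) v) (hy : y ∈ C.cone) : vol (ι a) v y ≤ 0 := by
  obtain ⟨s, p, q, hp, hq, rfl, -⟩ := h.exists_crossing hv hvol hy
  have : vol (ι a) v (p • ι a + q • ι b - s • v) = -(q * vol (ι a) (ι b) v) := by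
    simp only [vol, Pi.add_apply, Pi.sub_apply, Pi.smul_apply, smul_eq_mul]; ring
  rw [this]
  linarith [mul_nonneg hq hvol.le]

theorem vol_right_nonpos (h : IsFacet C E a b) {v y : Fin 3 → ℝ} (hv : v ∈ E.cone)
    (hvol : 0 < vol (ι a) (ι b) v) (hy : y ∈ C.cone) : vol v (ι b) y ≤ 0 := by
  obtain ⟨s, p, q, hp, hq, rfl, -⟩ := h.exists_crossing hv hvol hy
  have : vol v (ι b) (p • ι a + q • ι b - s • v) = -(p * vol (ι a) (ι b) v) := by
    simp only [vol, Pi.add_apply, Pi.sub_apply, Pi.smul_apply, smul_eq_mul]; ring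
  rw [this]
  linarith [mul_nonneg hp hvol.le]

/-- Seen from `a`, the generators beyond the facet are ordered by the slope `vol a e w / vol a b w`.
One of maximal slope spans with `a` a plane having all of `E` on one side. -/
theorem exists_supporting (h : IsFacet C E a b) {N : Finset (Fin 3 → ℤ)}
    (hE : E.cone = C.cone ⊔ PointedCone.hull ℝ (ι '' (N : Set (Fin 3 → ℤ))))
    {e : Fin 3 → ℤ} (he : e ∈ N) (hvol : 0 < vol (ι a) (ι b) (ι e)) :
    ∃ m ∈ N, 0 < vol (ι a) (ι b) (ι m) ∧ ∀ y ∈ E.cone, vol (ι a) (ι m) y ≤ 0 := by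
  classical
  have hNE : ∀ w ∈ N, ι w ∈ E.cone := fun w hw => by
    rw [hE]
    exact Submodule.mem_sup_right (PointedCone.subset_hull (Set.mem_image_of_mem _ hw))
  obtain ⟨m, hm, hmax⟩ := (N.filter (fun w => 0 < vol (ι a) (ι b) (ι w))).exists_max_image
    (fun w => vol (ι a) (ι e) (ι w) / vol (ι a) (ι b) (ι w)) ⟨e, Finset.mem_filter.2 ⟨he, hvol⟩⟩
  obtain ⟨hm, hmv⟩ := Finset.mem_filter.1 hm
  refine ⟨m, hm, hmv, fun y hy => ?_⟩
  rw [hE] at hy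
  refine nonpos_of_mem_sup_hull (volRight (ι a) (ι m))
    (fun y hy => h.vol_left_nonpos (hNE m hm) hmv hy) (fun w hw => ?_) hy
  rw [volRight_apply]
  rcases lt_or_ge 0 (vol (ι a) (ι b) (ι w)) with hw0 | hw0
  · have := hmax w (Finset.mem_filter.2 ⟨hw, hw0⟩)
    rw [div_le_div_iff₀ hw0 hmv] at this
    have hpl := vol_plucker (ι a) (ι b) (ι e) (ι m) (ι w)
    by_contra! hpos
    have := mul_pos hvol hpos
    linarith
  · exact h.vol_left_nonpos (hNE m hm) hmv (h.mem _ (hNE w hw) hw0)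

/-- Adding a vector `m` such that the plane of `a, m` supports the big cone moves the plane that
cuts off the small cone to the plane of `m, b`. -/
theorem step (h : IsFacet C E a b) (hm : ι m ∈ E.cone) (hvol : 0 < vol (ι a) (ι b) (ι m))
    (hsupp : ∀ y ∈ E.cone, vol (ι a) (ι m) y ≤ 0)
    (hG : G.cone = C.cone ⊔ PointedCone.hull ℝ {ι m}) :
    G.cone ≤ E.cone ∧ (∀ y ∈ G.cone, vol (ι m) (ι b) y ≤ 0) ∧
      ∀ y ∈ E.cone, vol (ι m) (ι b) y ≤ 0 → y ∈ G.cone := by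
  refine ⟨?_, fun y hy => ?_, fun y hy hy2 => ?_⟩
  · rw [hG]
    refine sup_le h.le (Submodule.span_le.2 ?_)
    rintro _ rfl
    exact hm
  · rw [hG, mem_sup_hull_singleton] at hy
    obtain ⟨c, hc, s, -, rfl⟩ := hy
    rw [vol_add_right, vol_smul_right, vol_self_left, mul_zero, add_zero]
    exact h.vol_right_nonpos hm hvol hc
  · have hCG : C.cone ≤ G.cone := hG ▸ le_sup_left
    rcases le_or_gt (vol (ι a) (ι b) y) 0 with hy0 | hy0
    · exact hCG (h.mem y hy hy0)
    · have hmG : ι m ∈ G.cone := by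
        rw [hG]; exact Submodule.mem_sup_right (PointedCone.subset_hull rfl)
      -- The three Cramer coefficients of `y` with respect to `a, b, m` are nonnegative by `hy2`,
      -- `hsupp` and `hy0`.
      rw [← G.cone.smul_mem_iff hvol, vol_cramer]
      exact G.cone.add_mem (G.cone.add_mem
        (G.cone.smul_mem (neg_nonneg.2 hy2) (hCG h.left_mem))
        (G.cone.smul_mem (neg_nonneg.2 (hsupp y hy)) (hCG h.right_mem)))
        (G.cone.smul_mem hy0.le hmG)

/-- The witness `w` says that something of `E` remains beyond the new plane. Without it, `E` could
meet the plane of `m, b` in more than the cone on `m` and `b`. -/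
theorem isFacet_step (h : IsFacet C E a b) (hm : ι m ∈ E.cone)
    (hvol : 0 < vol (ι a) (ι b) (ι m)) (hsupp : ∀ y ∈ E.cone, vol (ι a) (ι m) y ≤ 0)
    (hG : G.cone = C.cone ⊔ PointedCone.hull ℝ {ι m})
    {w : Fin 3 → ℝ} (hw : w ∈ E.cone) (hwvol : 0 < vol (ι m) (ι b) w) : IsFacet G E m b := by
  obtain ⟨h1, h2, h3⟩ := h.step hm hvol hsupp hG
  have hCG : C.cone ≤ G.cone := hG ▸ le_sup_left
  have hmG : ι m ∈ G.cone := by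
    rw [hG]; exact Submodule.mem_sup_right (PointedCone.subset_hull rfl)
  refine ⟨h1, hmG, hCG h.right_mem, h2, h3, fun y hy hy0 => ?_⟩
  have hcr := vol_cramer (ι a) (ι b) (ι m) y
  rw [hy0, neg_zero, zero_smul, zero_add] at hcr
  refine ⟨vol (ι a) (ι b) y / vol (ι a) (ι b) (ι m), -vol (ι a) (ι m) y / vol (ι a) (ι b) (ι m),
    div_nonneg ?_ hvol.le, div_nonneg (neg_nonneg.2 (hsupp y hy)) hvol.le, ?_⟩
  -- If `y` were strictly inside the old plane, a point `y + ε • w` would lie on that plane, hence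
  -- in `C`, yet strictly beyond the plane of `m, b`.
  · by_contra! hneg
    have hw0 : 0 < vol (ι a) (ι b) w := by
      by_contra! hle
      exact absurd (h2 w (hCG (h.mem w hw hle))) (not_le.2 hwvol)
    have hε : 0 < -vol (ι a) (ι b) y / vol (ι a) (ι b) w := div_pos (neg_pos.2 hneg) hw0
    have := h2 _ (hCG (h.mem (y + (-vol (ι a) (ι b) y / vol (ι a) (ι b) w) • w)
      (E.cone.add_mem hy (E.cone.smul_mem hε.le hw)) (by
        rw [vol_add_right, vol_smul_right, div_mul_cancel₀ _ hw0.ne']; linarith)))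
    rw [vol_add_right, vol_smul_right, hy0, zero_add] at this
    exact absurd this (not_le.2 (mul_pos hε hwvol))
  · rw [← sub_eq_zero]
    have : vol (ι a) (ι b) (ι m) • (y - ((vol (ι a) (ι b) y / vol (ι a) (ι b) (ι m)) • ι m +
        (-vol (ι a) (ι m) y / vol (ι a) (ι b) (ι m)) • ι b)) = 0 := by
      rw [smul_sub, hcr, smul_add, smul_smul, smul_smul, mul_div_cancel₀ _ hvol.ne',
        mul_div_cancel₀ _ hvol.ne']
      abel
    exact (smul_eq_zero.1 this).resolve_left hvol.ne'

end IsFacet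

/-- Adding finitely many vectors beyond a facet one by one, sweeping the cutting plane around `b`.
The predicate `Φ` is an invariant of the sweep. -/
theorem le_of_sweep {E : Cones 3} {b : Fin 3 → ℤ} {N : Finset (Fin 3 → ℤ)}
    {Φ : (Fin 3 → ℤ) → Prop}
    (hstep : ∀ (C : Cones 3) (a m : Fin 3 → ℤ), IsFacet C E a b → Φ a → m ∈ N →
      0 < vol (ι a) (ι b) (ι m) → (∀ y ∈ E.cone, vol (ι a) (ι m) y ≤ 0) →
      (∀ G : Cones 3, G.cone = C.cone ⊔ PointedCone.hull ℝ {ι m} → G.cone ≤ E.cone → C ≤ G) ∧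
        ((∃ w ∈ N, 0 < vol (ι m) (ι b) (ι w)) → Φ m))
    {C : Cones 3} {a : Fin 3 → ℤ} (h : IsFacet C E a b) (ha : Φ a)
    (hE : E.cone = C.cone ⊔ PointedCone.hull ℝ (ι '' (N : Set (Fin 3 → ℤ)))) : C ≤ E := by
  classical
  -- The measure is the number of vectors of `N` beyond the cutting plane. It drops at each step,
  -- since `m` itself lies on the next plane.
  induction hk : (N.filter (fun w => 0 < vol (ι a) (ι b) (ι w))).card using Nat.strong_induction_on
    generalizing C a with
  | _ k ih =>
  have hNE : ∀ w ∈ N, ι w ∈ E.cone := fun w hw => by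
    rw [hE]
    exact Submodule.mem_sup_right (PointedCone.subset_hull (Set.mem_image_of_mem _ hw))
  by_cases hex : ∃ e ∈ N, 0 < vol (ι a) (ι b) (ι e)
  · obtain ⟨e, he, hevol⟩ := hex
    obtain ⟨m, hm, hmvol, hsupp⟩ := h.exists_supporting hE he hevol
    obtain ⟨hP, hΦ⟩ := hstep C a m h ha hm hmvol hsupp
    obtain ⟨G, hG, hGE⟩ := exists_sup_singleton C E h.le (hNE m hm)
    obtain ⟨-, hG2, hG3⟩ := h.step (hNE m hm) hmvol hsupp hG
    have hCG : C.cone ≤ G.cone := hG ▸ le_sup_left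
    refine (hP G hG hGE).trans ?_
    by_cases hex2 : ∃ w ∈ N, 0 < vol (ι m) (ι b) (ι w)
    · obtain ⟨w, hw, hwvol⟩ := hex2
      refine ih _ ?_ (h.isFacet_step (hNE m hm) hmvol hsupp hG (hNE w hw) hwvol)
        (hΦ ⟨w, hw, hwvol⟩) (le_antisymm ?_ ?_) rfl
      · rw [← hk]
        refine Finset.card_lt_card ⟨fun x hx => ?_, fun hsub => ?_⟩
        · rw [Finset.mem_filter] at hx ⊢
          refine ⟨hx.1, ?_⟩
          by_contra! hle
          exact absurd (hG2 _ (hCG (h.mem _ (hNE x hx.1) hle))) (not_le.2 hx.2)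
        · have := (Finset.mem_filter.1 (hsub (Finset.mem_filter.2 ⟨hm, hmvol⟩))).2
          rw [vol_self_left] at this
          exact lt_irrefl _ this
      · rw [hE]; exact sup_le_sup_right hCG _
      · refine sup_le hGE (Submodule.span_le.2 ?_)
        rintro _ ⟨w, hw, rfl⟩
        exact hNE w hw
    · push Not at hex2
      refine le_of_cone_eq (le_antisymm hGE ?_)
      rw [hE]
      refine sup_le hCG (Submodule.span_le.2 ?_)
      rintro _ ⟨w, hw, rfl⟩
      exact hG3 _ (hNE w hw) (hex2 w hw)
  · push Not at hex
    refine le_of_cone_eq (le_antisymm h.le ?_)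
    rw [hE]
    refine sup_le le_rfl (Submodule.span_le.2 ?_)
    rintro _ ⟨w, hw, rfl⟩
    exact h.mem _ (hNE w hw) (hex w hw)

/-! ### One vector beyond a facet: descent on the determinant. -/

theorem vol_combination_left (a b v : Fin 3 → ℝ) (x y z p q r : ℝ) :
    vol a (x • a + y • b + z • v) (p • a + q • b + r • v) = (y * r - z * q) * vol a b v := by
  simp only [vol, Pi.add_apply, Pi.smul_apply, smul_eq_mul]; ring

theorem vol_combination_right (a b v : Fin 3 → ℝ) (x y z p q r : ℝ) :
    vol (x • a + y • b + z • v) b (p • a + q • b + r • v) = (x * r - z * p) * vol a b v := by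
  simp only [vol, Pi.add_apply, Pi.smul_apply, smul_eq_mul]; ring

theorem vol_combination_base (a b v : Fin 3 → ℝ) (x y z : ℝ) :
    vol a b (x • a + y • b + z • v) = z * vol a b v := by
  simp only [vol, Pi.add_apply, Pi.smul_apply, smul_eq_mul]; ring

theorem vol_combination_apex (a b v : Fin 3 → ℝ) (x y z : ℝ) :
    vol (x • a + y • b + z • v) b v = x * vol a b v := by
  simp only [vol, Pi.add_apply, Pi.smul_apply, smul_eq_mul]; ring

/-- A vector of the simplicial cone on `a, b, v` that lies on the inner side of the plane of `a, m`
and beyond the plane of `m, b` lies in the simplicial cone on `m, b, v`. -/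
theorem exists_combination_of_vol {a b v m y : Fin 3 → ℝ} (hd : 0 < vol a b v)
    (hm : ∃ r s t : ℝ, 0 ≤ r ∧ 0 ≤ s ∧ 0 ≤ t ∧ m = r • a + s • b + t • v)
    (hmvol : 0 < vol a b m)
    (hy : ∃ r s t : ℝ, 0 ≤ r ∧ 0 ≤ s ∧ 0 ≤ t ∧ y = r • a + s • b + t • v)
    (h1 : vol a m y ≤ 0) (h2 : 0 < vol m b y) :
    0 < vol m b v ∧ ∃ r s t : ℝ, 0 ≤ r ∧ 0 ≤ s ∧ 0 ≤ t ∧ y = r • m + s • b + t • v := by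
  obtain ⟨r, s, t, hr, hs, ht, rfl⟩ := hm
  obtain ⟨p, q, u, hp, hq, hu, rfl⟩ := hy
  rw [vol_combination_base] at hmvol
  rw [vol_combination_left] at h1
  rw [vol_combination_right] at h2
  rw [vol_combination_apex]
  have ht' : 0 < t := pos_of_mul_pos_left hmvol hd.le
  have h1' : s * u - t * q ≤ 0 := nonpos_of_mul_nonpos_left h1 hd
  have h2' : 0 < r * u - t * p := pos_of_mul_pos_left h2 hd.le
  -- If `r = 0`, then `m` lies in the cone on `b, v` and nothing of the simplicial cone is beyond
  -- the plane of `m, b`. Once `r > 0`, solving `m = r • a + s • b + t • v` for `a` and substituting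
  -- in `y` gives the coefficients below.
  have hr' : 0 < r := by
    rcases hr.eq_or_lt with rfl | hr
    · nlinarith [mul_nonneg ht hp]
    · exact hr
  refine ⟨mul_pos hr' hd, p / r, (r * q - p * s) / r, (r * u - t * p) / r, by positivity,
    div_nonneg ?_ hr, div_nonneg h2'.le hr, ?_⟩
  -- This is the identity `t (r q - p s) = s (r u - t p) + r (t q - s u)`.
  · have : 0 ≤ t * (r * q - p * s) := by
      nlinarith [mul_nonneg hs h2'.le, mul_nonneg hr (neg_nonneg.2 h1')]
    exact nonneg_of_mul_nonneg_right this ht'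
  · ext i
    simp only [Pi.add_apply, Pi.smul_apply, smul_eq_mul]
    field_simp
    ring

/-- The half-open parallelepiped spanned by `a, b, v` contains finitely many lattice points. -/
theorem finite_box (a b v : Fin 3 → ℤ) : {w : Fin 3 → ℤ | ∃ x y z : ℝ, (0 ≤ x ∧ x < 1) ∧
    (0 ≤ y ∧ y < 1) ∧ (0 ≤ z ∧ z < 1) ∧ ι w = x • ι a + y • ι b + z • ι v}.Finite := by
  refine (Set.finite_Icc (fun i => -(|a i| + |b i| + |v i|))
    (fun i => |a i| + |b i| + |v i|)).subset ?_
  rintro w ⟨x, y, z, ⟨hx, hx1⟩, ⟨hy, hy1⟩, ⟨hz, hz1⟩, hw⟩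
  have key : ∀ i, |w i| ≤ |a i| + |b i| + |v i| := fun i => by
    have hi := congrFun hw i
    simp only [Pi.add_apply, Pi.smul_apply, smul_eq_mul, latticeIncl_apply] at hi
    have hle : ∀ (t c : ℝ), 0 ≤ t → t < 1 → |t * c| ≤ |c| := fun t c h0 h1 => by
      rw [abs_mul, abs_of_nonneg h0]
      exact mul_le_of_le_one_left (abs_nonneg _) h1.le
    have : |(w i : ℝ)| ≤ |(a i : ℝ)| + |(b i : ℝ)| + |(v i : ℝ)| := by
      rw [hi]
      exact (abs_add_three _ _ _).trans
        (add_le_add_three (hle _ _ hx hx1) (hle _ _ hy hy1) (hle _ _ hz hz1))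
    exact_mod_cast this
  exact ⟨fun i => (abs_le.1 (key i)).1, fun i => (abs_le.1 (key i)).2⟩

theorem smul_add_smul_add_smul_mem {P : PointedCone ℝ (Fin 3 → ℝ)} {a b c : Fin 3 → ℝ}
    (ha : a ∈ P) (hb : b ∈ P) (hc : c ∈ P) {r s t : ℝ} (hr : 0 ≤ r) (hs : 0 ≤ s) (ht : 0 ≤ t) :
    r • a + s • b + t • c ∈ P :=
  P.add_mem (P.add_mem (P.smul_mem hr ha) (P.smul_mem hs hb)) (P.smul_mem ht hc)

/-- Induction on an integer bound for the determinant. All box points are adjoined first, through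
steps of smaller determinant; the remaining extension by `v` is then elementary. -/
theorem le_of_isFacet_of_vol_lt (k : ℕ) : ∀ (C D : Cones 3) (a b v : Fin 3 → ℤ),
    IsFacet C D a b → D.cone = C.cone ⊔ PointedCone.hull ℝ {ι v} →
    0 < vol (ι a) (ι b) (ι v) → vol (ι a) (ι b) (ι v) < k → C ≤ D := by
  induction k with
  | zero =>
    intro C D a b v _ _ h0 h1
    rw [Nat.cast_zero] at h1
    exact absurd h0 h1.not_gt
  | succ k ih =>
    intro C D a b v h hD hvol hk
    have hvD : ι v ∈ D.cone := by
      rw [hD]; exact Submodule.mem_sup_right (PointedCone.subset_hull rfl)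
    have haD := h.le h.left_mem
    have hbD := h.le h.right_mem
    set N := (finite_box a b v).toFinset with hNdef
    have hN : ∀ w, w ∈ N ↔ ∃ x y z : ℝ, (0 ≤ x ∧ x < 1) ∧ (0 ≤ y ∧ y < 1) ∧ (0 ≤ z ∧ z < 1) ∧
        ι w = x • ι a + y • ι b + z • ι v := fun w => by simp [hNdef]
    obtain ⟨E, hE, hED⟩ := exists_sup_hull C D h.le N (fun w hw => by
      obtain ⟨x, y, z, hx, hy, hz, hw⟩ := (hN w).1 hw
      rw [mem_latticePoints, hw]
      exact smul_add_smul_add_smul_mem haD hbD hvD hx.1 hy.1 hz.1)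
    have hCE : C.cone ≤ E.cone := hE ▸ le_sup_left
    have hNE : ∀ w ∈ N, ι w ∈ E.cone := fun w hw => by
      rw [hE]
      exact Submodule.mem_sup_right (PointedCone.subset_hull (Set.mem_image_of_mem _ hw))
    have hcone : ∀ y ∈ D.cone, 0 < vol (ι a) (ι b) y →
        ∃ r s t : ℝ, 0 ≤ r ∧ 0 ≤ s ∧ 0 ≤ t ∧ y = r • ι a + s • ι b + t • ι v := by
      intro y hy hy0
      rw [hD, mem_sup_hull_singleton] at hy
      obtain ⟨c, hc, s, hs, rfl⟩ := hy
      obtain ⟨t, p, q, hp, hq, rfl, ht⟩ := h.exists_crossing hvD hvol hc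
      have he : p • ι a + q • ι b - t • ι v + s • ι v = p • ι a + q • ι b + (s - t) • ι v := by
        rw [sub_smul]; abel
      rw [he, vol_combination_base] at hy0
      exact ⟨p, q, s - t, hp, hq, (pos_of_mul_pos_left hy0 hvol.le).le, he⟩
    -- Invariants of the sweep at the edge vector `a'`: the determinant of `a', b, v` is positive
    -- and has not grown; what remains of `E` beyond the plane of `a', b` lies in the cone on `a',
    -- b, v`; every box point is lower over that plane than `v`. The last one makes the next
    -- determinant strictly smaller.
    have hCE' : C ≤ E := by
      refine le_of_sweep (Φ := fun a' => vol (ι a') (ι b) (ι v) ≤ vol (ι a) (ι b) (ι v) ∧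
        0 < vol (ι a') (ι b) (ι v) ∧
        (∀ y ∈ E.cone, 0 < vol (ι a') (ι b) y →
          ∃ r s t : ℝ, 0 ≤ r ∧ 0 ≤ s ∧ 0 ≤ t ∧ y = r • ι a' + s • ι b + t • ι v) ∧
        ∀ w ∈ N, vol (ι a') (ι b) (ι w) < vol (ι a') (ι b) (ι v))
        ?_ (h.mono hCE hED) ?_ hE
      · rintro C' a' m h' ⟨hle, hpos, hcone', hlt⟩ hm hmvol hsupp
        refine ⟨fun G hG hGE => ?_, ?_⟩
        · refine ih C' G a' b m (h'.mono (hG ▸ le_sup_left) hGE) hG hmvol ?_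
          -- Integrality turns `vol a' b m < vol a b v < k + 1` into `vol a' b m < k`.
          obtain ⟨i, hi⟩ := exists_int_vol a' b m
          obtain ⟨j, hj⟩ := exists_int_vol a b v
          have h1 := (hlt m hm).trans_le hle
          rw [hi, hj] at h1
          rw [hj] at hk
          rw [hi]
          have h2 : i < j := by exact_mod_cast h1
          have h3 : j < (k : ℤ) + 1 := by exact_mod_cast hk
          have h4 : i < (k : ℤ) := by omega
          exact_mod_cast h4
        · rintro ⟨w₀, hw₀, hw₀vol⟩
          have hmc := hcone' _ (hNE m hm) hmvol
          have hbase : ∀ y ∈ E.cone, 0 < vol (ι m) (ι b) y → 0 < vol (ι a') (ι b) y := by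
            intro y hy hy2
            by_contra! hle0
            exact absurd (h'.vol_right_nonpos (hNE m hm) hmvol (h'.mem y hy hle0)) (not_le.2 hy2)
          have hall : ∀ y ∈ E.cone, 0 < vol (ι m) (ι b) y → 0 < vol (ι m) (ι b) (ι v) ∧
              ∃ r s t : ℝ, 0 ≤ r ∧ 0 ≤ s ∧ 0 ≤ t ∧ y = r • ι m + s • ι b + t • ι v :=
            fun y hy hy2 => exists_combination_of_vol hpos hmc hmvol
              (hcone' y hy (hbase y hy hy2)) (hsupp y hy) hy2
          have hpos' := (hall _ (hNE w₀ hw₀) hw₀vol).1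
          refine ⟨?_, hpos', fun y hy hy2 => (hall y hy hy2).2, fun w hw => ?_⟩
          -- As `m` is a box point, its coordinate along the original `a` is below `1`, and this
          -- coordinate is the ratio of the two determinants.
          · obtain ⟨x, y, z, hx, -, -, hmx⟩ := (hN m).1 hm
            rw [hmx, vol_combination_apex]
            exact mul_le_of_le_one_left hvol.le hx.2.le
          · rcases le_or_gt (vol (ι m) (ι b) (ι w)) 0 with hw2 | hw2
            · exact hw2.trans_lt hpos'
            · obtain ⟨r, s, t, hr, hs, ht, hmx⟩ := hmc
              obtain ⟨p, q, u, hp, hq, hu, hwx⟩ := hcone' _ (hNE w hw) (hbase _ (hNE w hw) hw2)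
              have hwlt := hlt w hw
              rw [hmx, vol_combination_apex] at hpos'
              rw [hwx, vol_combination_base] at hwlt
              rw [hwx, hmx, vol_combination_right, vol_combination_apex]
              have hr' : 0 < r := pos_of_mul_pos_left hpos' hpos.le
              have hu1 : u < 1 := by
                by_contra! hu1
                exact absurd hwlt (not_lt.2 (le_mul_of_one_le_left hpos.le hu1))
              -- In coordinates for `a', b, v`, the claim is `r u - t p < r`, which follows from `u
              -- < 1`, `r > 0` and `t p ≥ 0`.
              exact mul_lt_mul_of_pos_right
                (by nlinarith [mul_nonneg ht hp, mul_pos hr' (sub_pos.2 hu1)]) hpos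
      · refine ⟨le_rfl, hvol, fun y hy => hcone y (hED hy), fun w hw => ?_⟩
        obtain ⟨x, y, z, -, -, hz, hw⟩ := (hN w).1 hw
        rw [hw, vol_combination_base]
        exact mul_lt_of_lt_one_left hvol hz.2
    refine hCE'.trans ?_
    by_cases hvE : ι v ∈ E.cone
    · refine le_of_cone_eq (le_antisymm hED ?_)
      rw [hD]
      refine sup_le hCE (Submodule.span_le.2 ?_)
      rintro _ rfl
      exact hvE
    · refine Relation.ReflTransGen.single ⟨hED, v, hvD, hvE, fun y => ⟨fun hy => ?_, ?_⟩⟩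
      · rcases le_or_gt (vol (ι a) (ι b) (ι y)) 0 with hy0 | hy0
        · exact ⟨y, hCE (h.mem _ hy hy0), 0, by simp⟩
        · obtain ⟨r, s, t, hr, hs, ht, hyx⟩ := hcone _ hy hy0
          -- The fractional parts give a box point, which lies in `E`. The multiples of `a` and `b`
          -- are in `C`, so only the multiple of `v` has to be split off.
          have hw : y - ⌊r⌋ • a - ⌊s⌋ • b - ⌊t⌋ • v ∈ N := by
            rw [hN]
            refine ⟨Int.fract r, Int.fract s, Int.fract t,
              ⟨Int.fract_nonneg r, Int.fract_lt_one r⟩, ⟨Int.fract_nonneg s, Int.fract_lt_one s⟩,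
              ⟨Int.fract_nonneg t, Int.fract_lt_one t⟩, ?_⟩
            simp only [map_sub, latticeIncl_zsmul, hyx, Int.fract, sub_smul]
            abel
          refine ⟨y - ⌊t⌋ • v, ?_, ⌊t⌋.toNat, ?_⟩
          · have hsum : y - ⌊t⌋ • v =
                (y - ⌊r⌋ • a - ⌊s⌋ • b - ⌊t⌋ • v) + ⌊r⌋ • a + ⌊s⌋ • b := by abel
            rw [hsum, mem_latticePoints, map_add, map_add, latticeIncl_zsmul, latticeIncl_zsmul]
            exact E.cone.add_mem (E.cone.add_mem (hNE _ hw)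
              (E.cone.smul_mem (by exact_mod_cast Int.floor_nonneg.2 hr) (hCE h.left_mem)))
              (E.cone.smul_mem (by exact_mod_cast Int.floor_nonneg.2 hs) (hCE h.right_mem))
          · have : ((⌊t⌋.toNat : ℕ) : ℤ) = ⌊t⌋ := Int.toNat_of_nonneg (Int.floor_nonneg.2 ht)
            rw [← natCast_zsmul, this]
            abel
      · rintro ⟨u, hu, n, rfl⟩
        exact D.latticePoints.add_mem (hED hu) (D.latticePoints.nsmul_mem hvD n)

/-- A cone over a single facet can be added by elementary extensions. -/
theorem le_of_isFacet_singleton {C D : Cones 3} {a b v : Fin 3 → ℤ} (h : IsFacet C D a b)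
    (hD : D.cone = C.cone ⊔ PointedCone.hull ℝ {ι v}) (hvol : 0 < vol (ι a) (ι b) (ι v)) :
    C ≤ D := by
  obtain ⟨k, hk⟩ := exists_nat_gt (vol (ι a) (ι b) (ι v))
  exact le_of_isFacet_of_vol_lt k C D a b v h hD hvol hk

theorem IsFacet.cones_le {C E : Cones 3} {a b : Fin 3 → ℤ} (h : IsFacet C E a b) : C ≤ E := by
  obtain ⟨N, hN⟩ := exists_eq_sup_hull h.le
  refine le_of_sweep (N := N) (Φ := fun _ => True) ?_ h trivial hN
  rintro C' a' m h' - - hmvol -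
  exact ⟨fun G hG hGE => le_of_isFacet_singleton (h'.mono (hG ▸ le_sup_left) hGE) hG hmvol,
    fun _ => trivial⟩

/-! ### Faces, spans and restriction of chains. -/

section Faces

variable {d : ℕ}

/-- A sum of nonpositive terms vanishes only if every term does, so only generators in the kernel of
`f` contribute. -/
theorem mem_hull_filter_of_eq_zero {S : Finset (Fin d → ℤ)} (f : (Fin d → ℝ) →ₗ[ℝ] ℝ)
    [DecidablePred fun s => f (latticeIncl d s) = 0]
    (hS : ∀ s ∈ S, f (latticeIncl d s) ≤ 0) {y : Fin d → ℝ}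
    (hy : y ∈ PointedCone.hull ℝ (latticeIncl d '' (S : Set (Fin d → ℤ)))) :
    f y ≤ 0 ∧ (f y = 0 → y ∈ PointedCone.hull ℝ (latticeIncl d ''
      ((S.filter fun s => f (latticeIncl d s) = 0 : Finset (Fin d → ℤ)) : Set (Fin d → ℤ)))) := by
  induction hy using Submodule.span_induction with
  | mem x hx =>
    obtain ⟨s, hs, rfl⟩ := hx
    exact ⟨hS s hs, fun h0 => PointedCone.subset_hull
      (Set.mem_image_of_mem _ (Finset.mem_coe.2 (Finset.mem_filter.2 ⟨hs, h0⟩)))⟩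
  | zero => exact ⟨by simp, fun _ => Submodule.zero_mem _⟩
  | add x z _ _ hx hz =>
    rw [map_add]
    exact ⟨add_nonpos hx.1 hz.1, fun h0 => Submodule.add_mem _
      (hx.2 (by linarith [hx.1, hz.1])) (hz.2 (by linarith [hx.1, hz.1]))⟩
  | smul a x _ hx =>
    rw [show a • x = (a : ℝ) • x from rfl, map_smul, smul_eq_mul]
    refine ⟨mul_nonpos_of_nonneg_of_nonpos a.2 hx.1, fun h0 => ?_⟩
    rcases mul_eq_zero.1 h0 with h | h
    · rw [h, zero_smul]; exact Submodule.zero_mem _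
    · exact PointedCone.smul_mem _ a.2 (hx.2 h)

/-- The face of a cone on which a nonpositive linear functional vanishes. -/
theorem exists_face (C : Cones d) (f : (Fin d → ℝ) →ₗ[ℝ] ℝ) (hf : ∀ y ∈ C.cone, f y ≤ 0) :
    ∃ (F : Cones d) (T : Finset (Fin d → ℤ)),
      F.cone = PointedCone.hull ℝ (latticeIncl d '' (T : Set (Fin d → ℤ))) ∧
      (∀ t ∈ T, t ∈ F.latticePoints) ∧ ∀ y, y ∈ F.cone ↔ y ∈ C.cone ∧ f y = 0 := by
  classical
  obtain ⟨S, hS⟩ := C.rational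
  have hSC : ∀ s ∈ S, latticeIncl d s ∈ C.cone := fun s hs => by
    rw [hS]; exact PointedCone.subset_hull (Set.mem_image_of_mem _ hs)
  have key : ∀ y, y ∈ PointedCone.hull ℝ (latticeIncl d ''
      ((S.filter fun s => f (latticeIncl d s) = 0 : Finset (Fin d → ℤ)) : Set (Fin d → ℤ))) ↔
      y ∈ C.cone ∧ f y = 0 := fun y => by
    constructor
    · intro hy
      have hyC : y ∈ C.cone := by
        rw [hS]
        exact Submodule.span_mono (Set.image_mono (Finset.coe_subset.2 (Finset.filter_subset _ _))) hy
      refine ⟨hyC, le_antisymm (hf y hyC) ?_⟩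
      have := nonpos_of_mem_sup_hull (P := ⊥) (-f) (fun y hy => by simp [(Submodule.mem_bot _).1 hy])
        (fun w hw => by
          have := (Finset.mem_filter.1 (Finset.mem_coe.1 hw)).2
          simp [this]) (Submodule.mem_sup_right hy)
      simpa using this
    · rintro ⟨hy, hy0⟩
      rw [hS] at hy
      exact (mem_hull_filter_of_eq_zero f (fun s hs => hf _ (hSC s hs)) hy).2 hy0
  exact ⟨⟨_, ⟨_, rfl⟩, fun x hx hx' => C.salient x ((key x).1 hx).1 ((key _).1 hx').1⟩, _, rfl,
    fun t ht => PointedCone.subset_hull (Set.mem_image_of_mem _ ht), key⟩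

theorem cone_le_of_latticePoints_le {C D : Cones d} (h : C.latticePoints ≤ D.latticePoints) :
    C.cone ≤ D.cone := by
  obtain ⟨S, hS⟩ := C.rational
  rw [hS]
  refine Submodule.span_le.2 ?_
  rintro _ ⟨s, hs, rfl⟩
  refine h ?_
  rw [mem_latticePoints, hS]
  exact PointedCone.subset_hull (Set.mem_image_of_mem _ hs)

/-- Chains of elementary extensions restrict to faces. -/
theorem le_of_le_face {A B : Cones d} (h : A ≤ B) (f : (Fin d → ℝ) →ₗ[ℝ] ℝ)
    (hf : ∀ y ∈ B.cone, f y ≤ 0) {C D : Cones d} (hC : ∀ y, y ∈ C.cone ↔ y ∈ A.cone ∧ f y = 0)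
    (hD : ∀ y, y ∈ D.cone ↔ y ∈ B.cone ∧ f y = 0) : C ≤ D := by
  change Relation.ReflTransGen IsElementaryExtension A B at h
  induction h generalizing D with
  | refl => exact le_of_cone_eq (PointedCone.ext fun y => by rw [hC, hD])
  | @tail B' B _ hB ih =>
    obtain ⟨hsub, x, hxB, hxB', hx⟩ := hB
    have hf' : ∀ y ∈ B'.cone, f y ≤ 0 := fun y hy => hf y (hsub hy)
    obtain ⟨D', -, -, -, hD'⟩ := exists_face B' f hf'
    refine (ih hf' hD').trans ?_
    have hDD : D'.cone ≤ D.cone := fun y hy =>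
      (hD y).2 ⟨hsub ((hD' y).1 hy).1, ((hD' y).1 hy).2⟩
    -- Both `f u` and `n * f x` are nonpositive and their sum is `0`, so each vanishes. Either `f x
    -- = 0` and the extension restricts to the faces, or always `n = 0` and the face does not
    -- change.
    have hdec : ∀ y ∈ D.latticePoints, ∃ u ∈ D'.latticePoints, ∃ n : ℕ, y = u + n • x ∧
        (n : ℝ) * f (latticeIncl d x) = 0 := fun y hy => by
      obtain ⟨hyB, hy0⟩ := (hD _).1 hy
      obtain ⟨u, hu, n, rfl⟩ := (hx y).1 hyB
      have hu0 := hf' _ hu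
      have hx0 := mul_nonpos_of_nonneg_of_nonpos n.cast_nonneg (hf _ hxB)
      rw [map_add, map_nsmul, map_add, map_nsmul, nsmul_eq_mul] at hy0
      exact ⟨u, (hD' _).2 ⟨hu, by linarith⟩, n, rfl, by linarith⟩
    by_cases hx0 : f (latticeIncl d x) = 0
    · have hxD : x ∈ D.latticePoints := (hD _).2 ⟨hxB, hx0⟩
      refine Relation.ReflTransGen.single
        ⟨hDD, x, hxD, fun hxD' => hxB' ((hD' _).1 hxD').1, fun y => ⟨fun hy => ?_, ?_⟩⟩
      · obtain ⟨u, hu, n, hy, -⟩ := hdec y hy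
        exact ⟨u, hu, n, hy⟩
      · rintro ⟨u, hu, n, rfl⟩
        exact D.latticePoints.add_mem (hDD hu) (D.latticePoints.nsmul_mem hxD n)
    · refine le_of_cone_eq (le_antisymm hDD (cone_le_of_latticePoints_le fun y hy => ?_))
      obtain ⟨u, hu, n, rfl, hn⟩ := hdec y hy
      have : n = 0 := by simpa [hx0] using hn
      simpa [this] using hu

/-- Extend a cone by a lattice vector outside of a hyperplane containing the cone. -/
theorem exists_sup_of_transversal (D : Cones d) (f : (Fin d → ℝ) →ₗ[ℝ] ℝ)
    (hf : ∀ y ∈ D.cone, f y = 0) {e : Fin d → ℤ} (he : f (latticeIncl d e) < 0) :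
    ∃ G : Cones d, G.cone = D.cone ⊔ PointedCone.hull ℝ {latticeIncl d e} := by
  classical
  obtain ⟨S, hS⟩ := D.rational
  refine ⟨⟨D.cone ⊔ PointedCone.hull ℝ {latticeIncl d e}, ⟨insert e S, ?_⟩, fun x hx hx' => ?_⟩,
    rfl⟩
  · rw [Finset.coe_insert, Set.image_insert_eq, hull_insert, hS]
  · obtain ⟨c, hc, s, hs, rfl⟩ := mem_sup_hull_singleton.1 hx
    obtain ⟨c', hc', s', hs', h⟩ := mem_sup_hull_singleton.1 hx'
    have hfx := congrArg f h
    simp only [map_neg, map_add, map_smul, hf c hc, hf c' hc', smul_eq_mul, zero_add] at hfx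
    have h0 : (s + s') * f (latticeIncl d e) = 0 := by linarith
    have h1 : s + s' = 0 := (mul_eq_zero.1 h0).resolve_right he.ne
    have hs0 : s = 0 := by linarith
    have hs0' : s' = 0 := by linarith
    subst hs0 hs0'
    simp only [zero_smul, add_zero] at h ⊢
    exact D.salient c hc (h ▸ hc')

/-- The linear span of the lattice points of a cone. -/
def linearSpan (C : Cones d) : Submodule ℝ (Fin d → ℝ) :=
  Submodule.span ℝ (latticeIncl d '' (C.latticePoints : Set (Fin d → ℤ)))

theorem mem_linearSpan {C : Cones d} {y : Fin d → ℝ} (hy : y ∈ C.cone) : y ∈ C.linearSpan := by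
  obtain ⟨S, hS⟩ := C.rational
  have hSC : (S : Set (Fin d → ℤ)) ⊆ C.latticePoints := fun s hs => by
    change latticeIncl d s ∈ C.cone
    rw [hS]; exact PointedCone.subset_hull (Set.mem_image_of_mem _ hs)
  rw [hS] at hy
  exact Submodule.span_mono (Set.image_mono hSC) (PointedCone.hull_le_span (R := ℝ) _ hy)

theorem linearSpan_le {C : Cones d} {V : Submodule ℝ (Fin d → ℝ)} (h : ∀ y ∈ C.cone, y ∈ V) :
    C.linearSpan ≤ V := by
  refine Submodule.span_le.2 ?_
  rintro _ ⟨s, hs, rfl⟩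
  exact h _ hs

theorem finrank_linearSpan_lt {C G : Cones d} (h : C.cone ≤ G.cone) {u : Fin d → ℝ}
    (hu : u ∈ G.cone) (hu' : u ∉ C.linearSpan) :
    Module.finrank ℝ C.linearSpan < Module.finrank ℝ G.linearSpan :=
  Submodule.finrank_lt_finrank_of_lt
    ⟨linearSpan_le fun _ hy => mem_linearSpan (h hy), fun hle => hu' (hle (mem_linearSpan hu))⟩

theorem finrank_linearSpan_le (C : Cones d) : Module.finrank ℝ C.linearSpan ≤ d := by
  simpa using Submodule.finrank_le C.linearSpan

end Faces

/-! ### Facets cut out by a linear functional. -/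

theorem vol_mul_eq {f : (Fin 3 → ℝ) →ₗ[ℝ] ℝ} {a b : Fin 3 → ℝ} (ha : f a = 0) (hb : f b = 0)
    (u y : Fin 3 → ℝ) : vol a b u * f y = vol a b y * f u := by
  have := congrArg f (vol_cramer a b u y)
  simpa [ha, hb] using this

/-- A finite set of lattice points in a plane section of a cone lies in the cone spanned by
two lattice points of that section. -/
theorem exists_extreme_pair {C : Cones 3} {f : (Fin 3 → ℝ) →ₗ[ℝ] ℝ} {u : Fin 3 → ℝ} (hu : 0 < f u)
    {p q : Fin 3 → ℤ} (hp : ι p ∈ C.cone) (hq : ι q ∈ C.cone) (hfp : f (ι p) = 0)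
    (hfq : f (ι q) = 0) (hpq : vol (ι p) (ι q) u ≠ 0) (T : Finset (Fin 3 → ℤ))
    (hT : ∀ t ∈ T, ι t ∈ C.cone ∧ f (ι t) = 0) :
    ∃ a b : Fin 3 → ℤ, ι a ∈ C.cone ∧ ι b ∈ C.cone ∧ f (ι a) = 0 ∧ f (ι b) = 0 ∧
      0 < vol (ι a) (ι b) u ∧ ∀ t ∈ T, ι t ∈ PointedCone.hull ℝ {ι a} ⊔ PointedCone.hull ℝ {ι b} := by
  classical
  induction T using Finset.induction_on with
  | empty =>
    rcases lt_or_gt_of_ne hpq with h | h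
    · exact ⟨q, p, hq, hp, hfq, hfp, by rw [vol_swap_left]; linarith, by simp⟩
    · exact ⟨p, q, hp, hq, hfp, hfq, h, by simp⟩
  | insert c T _ ih =>
    obtain ⟨a, b, ha, hb, hfa, hfb, hab, hcov⟩ := ih fun t ht => hT t (Finset.mem_insert_of_mem ht)
    obtain ⟨hc, hfc⟩ := hT c (Finset.mem_insert_self _ _)
    obtain ⟨r, s, hcrs⟩ : ∃ r s : ℝ, ι c = r • ι a + s • ι b := by
      have hc0 : vol (ι a) (ι b) (ι c) = 0 := by
        have := vol_mul_eq hfa hfb u (ι c)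
        rw [hfc, mul_zero] at this
        exact (mul_eq_zero.1 this.symm).resolve_right hu.ne'
      have hcr := vol_cramer (ι a) (ι b) u (ι c)
      rw [hc0, zero_smul, add_zero] at hcr
      refine ⟨(vol (ι a) (ι b) u)⁻¹ * -vol u (ι b) (ι c),
        (vol (ι a) (ι b) u)⁻¹ * -vol (ι a) u (ι c), ?_⟩
      rw [mul_smul, mul_smul, ← smul_add, ← hcr, inv_smul_smul₀ hab.ne']
    have hvac : vol (ι a) (ι c) u = s * vol (ι a) (ι b) u := by
      rw [hcrs]; simp only [vol, Pi.add_apply, Pi.smul_apply, smul_eq_mul]; ring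
    have hvcb : vol (ι c) (ι b) u = r * vol (ι a) (ι b) u := by
      rw [hcrs]; simp only [vol, Pi.add_apply, Pi.smul_apply, smul_eq_mul]; ring
    have hzero : r ≤ 0 → s ≤ 0 → r = 0 ∧ s = 0 := fun hr hs => by
      have h0 : ι c = 0 := by
        refine C.salient _ hc ?_
        have : -ι c = (-r) • ι a + (-s) • ι b := by rw [hcrs, neg_smul, neg_smul]; abel
        rw [this]
        exact C.cone.add_mem (C.cone.smul_mem (neg_nonneg.2 hr) ha)
          (C.cone.smul_mem (neg_nonneg.2 hs) hb)
      rw [h0] at hvac hvcb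
      have e1 : vol (ι a) 0 u = 0 := by simp [vol]
      have e2 : vol 0 (ι b) u = 0 := by simp [vol]
      rw [e1] at hvac
      rw [e2] at hvcb
      exact ⟨(mul_eq_zero.1 hvcb.symm).resolve_right hab.ne',
        (mul_eq_zero.1 hvac.symm).resolve_right hab.ne'⟩
    have hmem : ∀ {x y z : Fin 3 → ℝ} {r s : ℝ}, 0 ≤ r → 0 ≤ s → z = r • x + s • y →
        z ∈ PointedCone.hull ℝ {x} ⊔ PointedCone.hull ℝ {y} := fun hr hs hz => by
      rw [hz]
      exact Submodule.add_mem_sup (PointedCone.smul_mem _ hr (PointedCone.subset_hull rfl))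
        (PointedCone.smul_mem _ hs (PointedCone.subset_hull rfl))
    have hext : ∀ {x y : Fin 3 → ℝ}, ι c ∈ PointedCone.hull ℝ {x} ⊔ PointedCone.hull ℝ {y} →
        ι a ∈ PointedCone.hull ℝ {x} ⊔ PointedCone.hull ℝ {y} →
        ι b ∈ PointedCone.hull ℝ {x} ⊔ PointedCone.hull ℝ {y} →
        ∀ t ∈ insert c T, ι t ∈ PointedCone.hull ℝ {x} ⊔ PointedCone.hull ℝ {y} := fun {x y} h1 h2 h3 t ht => by
      rcases Finset.mem_insert.1 ht with rfl | ht
      · exact h1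
      · have hle : PointedCone.hull ℝ {ι a} ⊔ PointedCone.hull ℝ {ι b} ≤
            PointedCone.hull ℝ {x} ⊔ PointedCone.hull ℝ {y} :=
          sup_le (Submodule.span_le.2 (Set.singleton_subset_iff.2 h2))
            (Submodule.span_le.2 (Set.singleton_subset_iff.2 h3))
        exact hle (hcov t ht)
    have hl : ∀ {x y : Fin 3 → ℝ}, x ∈ PointedCone.hull ℝ {x} ⊔ PointedCone.hull ℝ {y} :=
      Submodule.mem_sup_left (PointedCone.subset_hull rfl)
    have hr : ∀ {x y : Fin 3 → ℝ}, y ∈ PointedCone.hull ℝ {x} ⊔ PointedCone.hull ℝ {y} :=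
      Submodule.mem_sup_right (PointedCone.subset_hull rfl)
    -- With `c = r a + s b`: if both coefficients are nonnegative the pair stays; if only `r` is
    -- positive, `c` replaces `a`; if only `s` is, `c` replaces `b`. Salience forces `c = 0` when
    -- neither is positive.
    rcases le_or_gt s 0 with hs0 | hs0
    · rcases le_or_gt r 0 with hr0 | hr0
      · obtain ⟨rfl, rfl⟩ := hzero hr0 hs0
        exact ⟨a, b, ha, hb, hfa, hfb, hab, hext (hmem le_rfl le_rfl hcrs) hl hr⟩
      · refine ⟨c, b, hc, hb, hfc, hfb, hvcb ▸ mul_pos hr0 hab, hext hl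
          (hmem (inv_nonneg.2 hr0.le) (mul_nonneg (inv_nonneg.2 hr0.le) (neg_nonneg.2 hs0)) ?_) hr⟩
        rw [hcrs, mul_smul, ← smul_add, neg_smul, add_neg_cancel_right, inv_smul_smul₀ hr0.ne']
    · rcases le_or_gt 0 r with hr0 | hr0
      · exact ⟨a, b, ha, hb, hfa, hfb, hab, hext (hmem hr0 hs0.le hcrs) hl hr⟩
      · refine ⟨a, c, ha, hc, hfa, hfc, hvac ▸ mul_pos hs0 hab, hext hr hl
          (hmem (mul_nonneg (inv_nonneg.2 hs0.le) (neg_nonneg.2 hr0.le))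
            (inv_nonneg.2 hs0.le) ?_)⟩
        rw [hcrs, mul_smul, ← smul_add, neg_smul, neg_add_cancel_left, inv_smul_smul₀ hs0.ne']

/-- A plane that cuts off `C` from `E` and contains two independent lattice points of `C` cuts
along a facet. -/
theorem exists_isFacet {C E : Cones 3} (hCE : C.cone ≤ E.cone) {f : (Fin 3 → ℝ) →ₗ[ℝ] ℝ}
    (hf : ∀ y ∈ C.cone, f y ≤ 0) (hE : ∀ y ∈ E.cone, f y ≤ 0 → y ∈ C.cone)
    {u : Fin 3 → ℝ} (hu : 0 < f u) {p q : Fin 3 → ℤ}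
    (hp : ι p ∈ C.cone) (hq : ι q ∈ C.cone) (hfp : f (ι p) = 0) (hfq : f (ι q) = 0)
    (hpq : vol (ι p) (ι q) u ≠ 0) : ∃ a b, IsFacet C E a b := by
  obtain ⟨F, T, hFT, hT, hF⟩ := exists_face C f hf
  obtain ⟨a, b, ha, hb, hfa, hfb, hab, hcov⟩ := exists_extreme_pair hu hp hq hfp hfq hpq T
    fun t ht => (hF _).1 (hT t ht)
  have hprop := vol_mul_eq hfa hfb u
  refine ⟨a, b, hCE, ha, hb, fun y hy => ?_, fun y hy hy0 => hE y hy ?_, fun y hy hy0 => ?_⟩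
  · have := mul_nonpos_of_nonneg_of_nonpos hab.le (hf y hy)
    rw [hprop] at this
    exact nonpos_of_mul_nonpos_left this hu
  · have := mul_nonpos_of_nonpos_of_nonneg hy0 hu.le
    rw [← hprop] at this
    by_contra! hpos
    exact absurd (mul_pos hab hpos) (not_lt.2 this)
  · have hfy : f y = 0 := by
      have := hprop y
      rw [hy0, zero_mul] at this
      exact (mul_eq_zero.1 this).resolve_left hab.ne'
    have hyF : y ∈ F.cone := (hF y).2 ⟨hE y hy hfy.le, hfy⟩
    rw [hFT] at hyF
    have hle : PointedCone.hull ℝ (ι '' (T : Set (Fin 3 → ℤ))) ≤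
        PointedCone.hull ℝ {ι a} ⊔ PointedCone.hull ℝ {ι b} := by
      refine Submodule.span_le.2 ?_
      rintro _ ⟨t, ht, rfl⟩
      exact hcov t ht
    obtain ⟨c, hc, s, hs, rfl⟩ := mem_sup_hull_singleton.1 (hle hyF)
    obtain ⟨r, rfl⟩ := Submodule.mem_span_singleton.1 hc
    exact ⟨r, s, r.2, hs, rfl⟩

/-- Otherwise, by linearity in each argument, the determinant would vanish on all triples containing
`u`, which forces `u = 0`. -/
theorem exists_vol_ne_zero {S : Set (Fin 3 → ℝ)} {u : Fin 3 → ℝ} (hu : u ≠ 0)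
    (hS : Submodule.span ℝ (insert u S) = ⊤) : ∃ c ∈ S, ∃ c' ∈ S, vol c c' u ≠ 0 := by
  by_contra! h
  have h1 : ∀ c ∈ S, ∀ y, vol u c y = 0 := fun c hc y => by
    have : volRight u c = 0 := LinearMap.ext_on hS fun x hx => by
      rw [volRight_apply, LinearMap.zero_apply]
      rcases Set.mem_insert_iff.1 hx with rfl | hx
      · exact vol_self_left _ _
      · rw [← vol_rotate u c x]; exact h c hc x hx
    exact LinearMap.congr_fun this y
  have h2 : ∀ x y, vol u x y = 0 := fun x y => by
    have : volRight y u = 0 := LinearMap.ext_on hS fun x hx => by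
      rw [volRight_apply, LinearMap.zero_apply]
      rcases Set.mem_insert_iff.1 hx with rfl | hx
      · exact vol_self_right _ _
      · rw [← vol_rotate y u x]; exact h1 x hx y
    have := LinearMap.congr_fun this x
    rwa [volRight_apply, LinearMap.zero_apply, ← vol_rotate y u x] at this
  refine hu (funext fun i => ?_)
  have e0 := h2 (Pi.single 1 1) (Pi.single 2 1)
  have e1 := h2 (Pi.single 2 1) (Pi.single 0 1)
  have e2 := h2 (Pi.single 0 1) (Pi.single 1 1)
  simp [vol] at e0 e1 e2
  fin_cases i <;> simp [e0, e1, e2]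

/-! ### From facets to arbitrary inclusions. -/

/-- The linear functional given by an integral vector. -/
def integralFunctional {d : ℕ} (m : Fin d → ℤ) : (Fin d → ℝ) →ₗ[ℝ] ℝ where
  toFun y := latticeIncl d m ⬝ᵥ y
  map_add' := dotProduct_add _
  map_smul' r y := dotProduct_smul r _ y

/-- If some `u` of `D` is beyond the plane `m = 0`, lattice points `c` of `C` are pushed along `u`
onto that plane as `(m ⬝ᵥ u) c - (m ⬝ᵥ c) u`. This is a nonnegative combination because `m ⬝ᵥ c ≤
0`. As `C` spans the space, two of these images are independent, so the plane cuts along a facet. -/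
theorem le_of_linearSpan_eq_top_of_halfspace {C E D : Cones 3} (hspan : C.linearSpan = ⊤)
    (hCE : C.cone ≤ E.cone) (m : Fin 3 → ℤ)
    (hE : ∀ y, y ∈ E.cone ↔ y ∈ D.cone ∧ ι m ⬝ᵥ y ≤ 0) : E ≤ D := by
  have hED : E.cone ≤ D.cone := fun y hy => ((hE y).1 hy).1
  by_cases hex : ∃ u ∈ D.latticePoints, 0 < m ⬝ᵥ u
  · obtain ⟨u, hu, hmu⟩ := hex
    have hmu' : 0 < ι m ⬝ᵥ ι u := by rw [latticeIncl_dotProduct]; exact_mod_cast hmu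
    have hu0 : ι u ≠ 0 := fun h => by rw [h, dotProduct_zero] at hmu'; exact lt_irrefl _ hmu'
    obtain ⟨_, ⟨c, hc, rfl⟩, _, ⟨c', hc', rfl⟩, hvol⟩ := exists_vol_ne_zero hu0
      (S := ι '' (C.latticePoints : Set (Fin 3 → ℤ)))
      (top_le_iff.1 (hspan.ge.trans (Submodule.span_mono (Set.subset_insert _ _))))
    have hproj : ∀ c ∈ C.latticePoints, ι ((m ⬝ᵥ u) • c - (m ⬝ᵥ c) • u) ∈ E.cone ∧
        ι m ⬝ᵥ ι ((m ⬝ᵥ u) • c - (m ⬝ᵥ c) • u) = 0 := fun c hc => by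
      obtain ⟨hcD, hc0⟩ := (hE _).1 (hCE hc)
      rw [latticeIncl_dotProduct] at hc0
      have h0 : ι m ⬝ᵥ ι ((m ⬝ᵥ u) • c - (m ⬝ᵥ c) • u) = 0 := by
        rw [latticeIncl_dotProduct, dotProduct_sub, dotProduct_smul, dotProduct_smul, smul_eq_mul,
          smul_eq_mul]
        simp [mul_comm]
      refine ⟨(hE _).2 ⟨?_, h0.le⟩, h0⟩
      rw [sub_eq_add_neg, ← neg_smul, map_add, latticeIncl_zsmul, latticeIncl_zsmul]
      refine D.cone.add_mem (D.cone.smul_mem (by exact_mod_cast hmu.le) hcD)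
        (D.cone.smul_mem ?_ hu)
      push_cast
      linarith
    obtain ⟨a, b, hab⟩ := exists_isFacet hED (f := integralFunctional m)
      (fun y hy => ((hE y).1 hy).2) (fun y hy hy0 => (hE y).2 ⟨hy, hy0⟩) (u := ι u) hmu'
      (hproj c hc).1 (hproj c' hc').1 (hproj c hc).2 (hproj c' hc').2 (by
        have : vol (ι ((m ⬝ᵥ u) • c - (m ⬝ᵥ c) • u)) (ι ((m ⬝ᵥ u) • c' - (m ⬝ᵥ c') • u)) (ι u) =
            ((m ⬝ᵥ u : ℤ) : ℝ) ^ 2 * vol (ι c) (ι c') (ι u) := by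
          simp only [map_sub, latticeIncl_zsmul, vol, Pi.sub_apply, Pi.smul_apply, smul_eq_mul]
          ring
        rw [this]
        exact mul_ne_zero (pow_ne_zero _ (by exact_mod_cast hmu.ne')) hvol)
    exact hab.cones_le
  · push Not at hex
    refine le_of_cone_eq (le_antisymm hED (cone_le_of_latticePoints_le fun y hy => ?_))
    refine (hE _).2 ⟨hy, ?_⟩
    rw [latticeIncl_dotProduct]
    exact_mod_cast hex y hy

theorem le_of_linearSpan_eq_top {C D : Cones 3} (hspan : C.linearSpan = ⊤)
    (h : C.cone ≤ D.cone) : C ≤ D := by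
  classical
  obtain ⟨M, hM⟩ := C.exists_halfspaces
  have hM1 : ∀ m ∈ M, ∀ y ∈ C.cone, ι m ⬝ᵥ y ≤ 0 := fun m hm y hy => (hM y).1 hy m hm
  have hM2 : ∀ y ∈ D.cone, (∀ m ∈ M, ι m ⬝ᵥ y ≤ 0) → y ∈ C.cone := fun y _ => (hM y).2
  clear hM
  induction M using Finset.induction_on generalizing D with
  | empty => exact le_of_cone_eq (le_antisymm h fun y hy => hM2 y hy (by simp))
  | insert m M _ ih =>
    obtain ⟨E, hE⟩ := exists_inter_halfspace D m
    have hCE : C.cone ≤ E.cone := fun y hy =>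
      (hE y).2 ⟨h hy, hM1 m (Finset.mem_insert_self _ _) y hy⟩
    refine (ih hCE (fun k hk => hM1 k (Finset.mem_insert_of_mem hk)) fun y hy hyM => ?_).trans
      (le_of_linearSpan_eq_top_of_halfspace hspan hCE m hE)
    obtain ⟨hyD, hym⟩ := (hE y).1 hy
    exact hM2 y hyD (Finset.forall_mem_insert _ _ _ |>.2 ⟨hym, hyM⟩)

/-- Inclusion of cones in a common hyperplane reduces to inclusion of cones of larger dimension. -/
theorem le_of_vanishing {d : ℕ} {C D : Cones d} (h : C.cone ≤ D.cone)
    {f : (Fin d → ℝ) →ₗ[ℝ] ℝ} (hf : f ≠ 0) (hD : ∀ y ∈ D.cone, f y = 0)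
    (ih : ∀ C' D' : Cones d, C'.cone ≤ D'.cone →
      Module.finrank ℝ C.linearSpan < Module.finrank ℝ C'.linearSpan → C' ≤ D') : C ≤ D := by
  obtain ⟨e, he⟩ : ∃ e : Fin d → ℤ, f (latticeIncl d e) < 0 := by
    by_contra! hcon
    refine hf (LinearMap.pi_ext' fun i => LinearMap.ext_ring ?_)
    have key : latticeIncl d (Pi.single i 1) = Pi.single i 1 := by
      ext j; simp [latticeIncl_apply, Pi.single_apply]
    have h1 := hcon (Pi.single i 1)
    have h2 := hcon (-Pi.single i 1)
    rw [map_neg, key, map_neg] at h2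
    rw [key] at h1
    simpa using le_antisymm (by linarith) h1
  obtain ⟨B, hB⟩ := exists_sup_of_transversal D f hD he
  have heB : latticeIncl d e ∈ B.cone := by
    rw [hB]; exact Submodule.mem_sup_right (PointedCone.subset_hull rfl)
  obtain ⟨A, hA, hAB⟩ := exists_sup_singleton C B (h.trans (hB ▸ le_sup_left)) heB
  have hC : ∀ y ∈ C.cone, f y = 0 := fun y hy => hD y (h hy)
  have heA : latticeIncl d e ∈ A.cone := by
    rw [hA]; exact Submodule.mem_sup_right (PointedCone.subset_hull rfl)
  have hface : ∀ {P Q : Cones d}, Q.cone = P.cone ⊔ PointedCone.hull ℝ {latticeIncl d e} →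
      (∀ y ∈ P.cone, f y = 0) →
      (∀ y ∈ Q.cone, f y ≤ 0) ∧ ∀ y, y ∈ P.cone ↔ y ∈ Q.cone ∧ f y = 0 := by
    intro P Q hQ hP
    constructor
    · intro y hy
      rw [hQ, mem_sup_hull_singleton] at hy
      obtain ⟨c, hc, s, hs, rfl⟩ := hy
      rw [map_add, map_smul, hP c hc, zero_add]
      exact mul_nonpos_of_nonneg_of_nonpos hs he.le
    · refine fun y => ⟨fun hy => ⟨hQ ▸ Submodule.mem_sup_left hy, hP y hy⟩, ?_⟩
      rintro ⟨hy, hy0⟩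
      rw [hQ, mem_sup_hull_singleton] at hy
      obtain ⟨c, hc, s, hs, rfl⟩ := hy
      rw [map_add, map_smul, hP c hc, zero_add, smul_eq_mul] at hy0
      rw [(mul_eq_zero.1 hy0).resolve_right he.ne, zero_smul, add_zero]
      exact hc
  -- `A` and `B` are `C` and `D` enlarged by the transversal vector `e`. The dimension of `A`
  -- exceeds that of `C`, so induction applies, and `C`, `D` are the faces `f = 0`.
  refine le_of_le_face (ih A B hAB (finrank_linearSpan_lt (hA ▸ le_sup_left) heA fun hmem => ?_)) f
    (hface hB hD).1 (hface hA hC).2 (hface hB hD).2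
  exact he.ne ((linearSpan_le (V := LinearMap.ker f) fun y hy => LinearMap.mem_ker.2 (hC y hy)) hmem)

theorem le_of_cone_le {C D : Cones 3} (h : C.cone ≤ D.cone) : C ≤ D := by
  induction hk : 3 - Module.finrank ℝ C.linearSpan using Nat.strong_induction_on
    generalizing C D with
  | _ k ih =>
  have ih' : ∀ C' D' : Cones 3, C'.cone ≤ D'.cone →
      Module.finrank ℝ C.linearSpan < Module.finrank ℝ C'.linearSpan → C' ≤ D' :=
    fun C' D' h' hlt => ih _ (by have := finrank_linearSpan_le C'; omega) h' rfl
  by_cases hspan : C.linearSpan = ⊤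
  · exact le_of_linearSpan_eq_top hspan h
  obtain ⟨f, hf, hker⟩ := Submodule.exists_le_ker_of_lt_top _ (lt_top_iff_ne_top.2 hspan)
  have hC : ∀ {y}, y ∈ C.cone → f y = 0 := fun hy => LinearMap.mem_ker.1 (hker (mem_linearSpan hy))
  by_cases hex : ∃ u ∈ D.latticePoints, f (ι u) ≠ 0
  · obtain ⟨u, hu, hfu⟩ := hex
    obtain ⟨G, hG, hGD⟩ := exists_sup_singleton C D h hu
    have hCG : C.cone ≤ G.cone := hG ▸ le_sup_left
    have huG : ι u ∈ G.cone := by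
      rw [hG]; exact Submodule.mem_sup_right (PointedCone.subset_hull rfl)
    have huC : ι u ∉ C.linearSpan := fun hmem => hfu (LinearMap.mem_ker.1 (hker hmem))
    refine le_trans ?_ (ih' G D hGD (finrank_linearSpan_lt hCG huG huC))
    -- If `G` spans the space, `C` spans a plane and is itself the face of `G` in that plane, so one
    -- facet is crossed. Otherwise `G` lies in a hyperplane.
    by_cases hspanG : G.linearSpan = ⊤
    · have hu0 : ι u ≠ 0 := fun h0 => hfu (by rw [h0, map_zero])
      have hins : Submodule.span ℝ (insert (ι u) (ι '' (C.latticePoints : Set (Fin 3 → ℤ)))) = ⊤ := by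
        rw [← top_le_iff, ← hspanG]
        refine linearSpan_le fun y hy => ?_
        rw [hG, mem_sup_hull_singleton] at hy
        obtain ⟨c, hc, s, -, rfl⟩ := hy
        exact Submodule.add_mem _ (Submodule.span_mono (Set.subset_insert _ _) (mem_linearSpan hc))
          (Submodule.smul_mem _ _ (Submodule.subset_span (Set.mem_insert _ _)))
      obtain ⟨_, ⟨c, hc, rfl⟩, _, ⟨c', hc', rfl⟩, hvol⟩ := exists_vol_ne_zero hu0 hins
      -- The factor `f (ι u)` normalizes the sign, making the functional positive at `u`.
      have hgC : ∀ y ∈ C.cone, (f (ι u) • f) y = 0 := fun y hy => by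
        rw [LinearMap.smul_apply, hC hy, smul_zero]
      have hgu : 0 < (f (ι u) • f) (ι u) := by
        rw [LinearMap.smul_apply, smul_eq_mul]; exact mul_self_pos.2 hfu
      obtain ⟨a, b, hab⟩ := exists_isFacet hCG (f := f (ι u) • f) (fun y hy => (hgC y hy).le)
        (fun y hy hy0 => by
          rw [hG, mem_sup_hull_singleton] at hy
          obtain ⟨c, hc, s, hs, rfl⟩ := hy
          rw [map_add, map_smul, hgC c hc, zero_add, smul_eq_mul] at hy0
          rw [le_antisymm (nonpos_of_mul_nonpos_left hy0 hgu) hs, zero_smul, add_zero]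
          exact hc)
        hgu hc hc' (hgC _ hc) (hgC _ hc') hvol
      exact hab.cones_le
    · obtain ⟨g, hg, hkerG⟩ := Submodule.exists_le_ker_of_lt_top _ (lt_top_iff_ne_top.2 hspanG)
      exact le_of_vanishing hCG hg
        (fun y hy => LinearMap.mem_ker.1 (hkerG (mem_linearSpan hy))) ih'
  · push Not at hex
    refine le_of_vanishing h hf (fun y hy => ?_) ih'
    refine LinearMap.mem_ker.1 ((Submodule.span_le.2 ?_ : D.linearSpan ≤ LinearMap.ker f)
      (mem_linearSpan hy))
    rintro _ ⟨w, hw, rfl⟩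
    exact hex w hw

end Cones

/-- The order in `Cones(3)`, generated by elementary extensions, is the inclusion order. -/
theorem theorem3p2 :
    (∀ C D : Cones 3, C ≤ D ↔ (C.cone : Set (Fin 3 → ℝ)) ⊆ (D.cone : Set (Fin 3 → ℝ))) ∧
    (∀ C D : Cones 3, C < D ↔ (C.cone : Set (Fin 3 → ℝ)) ⊂ (D.cone : Set (Fin 3 → ℝ))) := by
  refine ⟨fun C D => ⟨Cones.cone_le_of_le, Cones.le_of_cone_le⟩,
    fun C D => ⟨Cones.ssubset_of_transGen, fun h => ?_⟩⟩
  refine lt_of_le_of_ne (Cones.le_of_cone_le h.1) ?_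
  rintro rfl
  exact h.2 subset_rfl
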